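/- Let $W\subset GL(\mathbb R^\ell)$ be a finite group generated by orthogonal reflections, acting on $V=\mathbb C^\ell$ by complexification, and let $\Phi\subset\mathbb R^\ell$ be a root system for $W$: a $W$-stable set of nonzero vectors consisting of exactly one opposite pair $\{\pm\alpha\}$ of normals to each reflecting hyperplane of $W$. Let $W$ act on $S=\mathrm{Sym}(V^*)\cong\mathbb C[x_1,\dots,x_\ell]$ by linear substitutions, and let $S/I$ be the coinvariant algebra, where $I$ is the ideal generated by the $W$-invariant polynomials without constant term. For a finite-dimensional representation $U$ of $W$ over $\mathbb C$, its fake degree is $$f^U(q)=\mathrm{Hilb}\bigl(\mathrm{Hom}_W(U,S/I),q\bigr)=\sum_{d\ge 0}\dim_{\mathbb C}\mathrm{Hom}_W\bigl(U,(S/I)_d\bigr)\,q^d .$$ Let $\Phi'\subseteq\Phi$ be a $W$-orbit of roots. Then $\Phi'=-\Phi'$; let $\mathbb C[\Phi']^{+}$ and $\mathbb C[\Phi']^{-}$ be the eigenspaces, for the eigenvalues $+1$ and $-1$, of the $W$-equivariant involution of the permutation representation $\mathbb C[\Phi']$ that swaps the basis elements $\alpha$ and $-\alpha$ for every $\alpha\in\Phi'$,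 so that $\mathbb C[\Phi']=\mathbb C[\Phi']^{+}\oplus\mathbb C[\Phi']^{-}$ as representations of $W$. Write $f^{\Phi'}$, $f^{\Phi',+}$, $f^{\Phi',-}$ for the fake degrees of $\mathbb C[\Phi']$, $\mathbb C[\Phi']^{+}$, $\mathbb C[\Phi']^{-}$. Then $$f^{\Phi'}(q)=f^{\Phi',+}(q)+f^{\Phi',-}(q),\qquad f^{\Phi',-}(q)=q\cdot f^{\Phi',+}(q),$$ and any one of the three determines the others via these relations: if power series $a,b,c\in\mathbb Z[[q]]$ satisfy $a=b+c$ and $c=q\,b$, and at least one of $a=f^{\Phi'}$, $b=f^{\Phi',+}$, $c=f^{\Phi',-}$ holds, then all three hold. -/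

import Mathlib

open scoped PowerSeries

noncomputable section

namespace ReflFakeDegree

/-- The real vector space `ℝ^l` with its Euclidean inner product. -/
abbrev RealSpace (l : ℕ) : Type := EuclideanSpace ℝ (Fin l)

/-- The orthogonal reflection of `ℝ^l` in the hyperplane `v^⊥` (for `v ≠ 0`),
as an element of `GL(ℝ^l)`. -/
def hyperplaneReflection {l : ℕ} (v : RealSpace l) : RealSpace l ≃ₗ[ℝ] RealSpace l :=
  ((Submodule.span ℝ {v})ᗮ.reflection).toLinearEquiv

/-- A finite real reflection group: a finite subgroup of `GL(ℝ^l)` that is generated by orthogonal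
reflections in hyperplanes (so it preserves the standard inner product). -/
structure IsFiniteReflectionGroup {l : ℕ} (W : Subgroup (RealSpace l ≃ₗ[ℝ] RealSpace l)) :
    Prop where
  finite : Finite W
  generated : Subgroup.closure {s | s ∈ W ∧ ∃ v : RealSpace l, v ≠ 0 ∧ s = hyperplaneReflection v}
    = W

/-- `Φ` is a root system for `W`: a `W`-stable set of nonzero vectors that consists of exactly
one opposite pair `±α` of normals to each reflecting hyperplane of `W`. -/
structure IsRootSystem {l : ℕ} (W : Subgroup (RealSpace l ≃ₗ[ℝ] RealSpace l))
    (Φ : Set (RealSpace l)) : Prop where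
  ne_zero : ∀ α ∈ Φ, α ≠ 0
  reflection_mem : ∀ α ∈ Φ, hyperplaneReflection α ∈ W
  normals : ∀ v : RealSpace l, v ≠ 0 → hyperplaneReflection v ∈ W →
    ∃ α : RealSpace l, Φ ∩ (Submodule.span ℝ {v} : Set (RealSpace l)) = {α, -α}
  stable : ∀ w ∈ W, ∀ α ∈ Φ, w α ∈ Φ

/-! ### The coinvariant algebra -/

/-- `S = Sym(V^*) = ℂ[x_1, …, x_l]`, the polynomial functions on `V = ℂ^l`, the complexification
of `ℝ^l`. -/
abbrev Poly (l : ℕ) : Type := MvPolynomial (Fin l) ℂ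

/-- The linear form `x_i ∘ g⁻¹` on `V = ℂ^l`. -/
def coordComp {l : ℕ} (g : RealSpace l ≃ₗ[ℝ] RealSpace l) (i : Fin l) : Poly l :=
  ∑ j, MvPolynomial.C ((g⁻¹ (EuclideanSpace.single j (1 : ℝ)) i : ℝ) : ℂ) * MvPolynomial.X j

theorem sum_coord_mul {l : ℕ} (g : RealSpace l ≃ₗ[ℝ] RealSpace l) (v : RealSpace l) (i : Fin l) :
    ∑ j, v j * g (EuclideanSpace.single j (1 : ℝ)) i = g v i := by
  have hv : v = ∑ j, v j • EuclideanSpace.single j (1 : ℝ) := by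
    ext k
    simp [Pi.single_apply]
  conv_rhs => rw [hv]
  simp [map_sum]

/-- The action of `GL(ℝ^l)` on `S` by linear substitutions, `(g • f)(v) = f(g⁻¹ v)`. -/
def polyAction (l : ℕ) : (RealSpace l ≃ₗ[ℝ] RealSpace l) →* (Poly l →ₐ[ℂ] Poly l) where
  toFun g := MvPolynomial.aeval (coordComp g)
  map_one' := by
    ext1 i
    simp [coordComp, apply_ite, ite_mul]
  map_mul' g h := by
    ext1 i
    simp only [MvPolynomial.aeval_X, AlgHom.mul_apply, coordComp, map_sum, map_mul,
      MvPolynomial.algHom_C, MvPolynomial.algebraMap_eq, Finset.mul_sum, mul_inv_rev]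
    rw [Finset.sum_comm]
    refine Finset.sum_congr rfl fun k _ => ?_
    rw [LinearEquiv.mul_apply, ← sum_coord_mul h⁻¹ (g⁻¹ _) i]
    push_cast
    simp only [map_sum, map_mul, Finset.sum_mul]
    exact Finset.sum_congr rfl fun j _ => by ring

variable {l : ℕ}

/-- The ideal `I` of `S` generated by the `W`-invariants without constant term. If
`S^W = ℂ[f_1, …, f_l]` with `f_i` homogeneous of positive degree, then `I = (f_1, …, f_l)`. -/
def invariantIdeal (W : Subgroup (RealSpace l ≃ₗ[ℝ] RealSpace l)) : Ideal (Poly l) :=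
  Ideal.span {f | (∀ w ∈ W, polyAction l w f = f) ∧ MvPolynomial.constantCoeff f = 0}

theorem invariantIdeal_le_comap (W : Subgroup (RealSpace l ≃ₗ[ℝ] RealSpace l)) (w : W) :
    invariantIdeal W ≤ (invariantIdeal W).comap (polyAction l w) := by
  refine Ideal.span_le.2 fun f hf => ?_
  simp only [SetLike.mem_coe, Ideal.mem_comap, hf.1 w w.2]
  exact Ideal.subset_span hf

/-- The coinvariant algebra `S/I`. -/
abbrev Coinvariant (W : Subgroup (RealSpace l ≃ₗ[ℝ] RealSpace l)) : Type :=
  Poly l ⧸ invariantIdeal W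

/-- The representation of `W` on the coinvariant algebra induced by its action on `S`. -/
def coinvariantRep (W : Subgroup (RealSpace l ≃ₗ[ℝ] RealSpace l)) :
    Representation ℂ W (Coinvariant W) where
  toFun w := (Ideal.quotientMapₐ (invariantIdeal W) (polyAction l w)
    (invariantIdeal_le_comap W w)).toLinearMap
  map_one' := by
    refine LinearMap.ext fun x => ?_
    obtain ⟨f, rfl⟩ := Ideal.Quotient.mk_surjective x
    simp
  map_mul' g h := by
    refine LinearMap.ext fun x => ?_
    obtain ⟨f, rfl⟩ := Ideal.Quotient.mk_surjective x
    simp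

/-- The homogeneous component `(S/I)_d`: the image of the homogeneous polynomials of degree `d`. -/
def coinvariantDegree (W : Subgroup (RealSpace l ≃ₗ[ℝ] RealSpace l)) (d : ℕ) :
    Submodule ℂ (Coinvariant W) :=
  (MvPolynomial.homogeneousSubmodule (Fin l) ℂ d).map
    (Ideal.Quotient.mkₐ ℂ (invariantIdeal W)).toLinearMap

/-! ### Fake degrees -/

/-- The degree `d` part `Hom_W(U, (S/I)_d)` of the graded vector space `Hom_W(U, S/I)`. -/
def homDegree {W : Subgroup (RealSpace l ≃ₗ[ℝ] RealSpace l)} {U : Type*} [AddCommGroup U]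
    [Module ℂ U] (ρ : Representation ℂ W U) (d : ℕ) :
    Submodule ℂ (Representation.IntertwiningMap ρ (coinvariantRep W)) where
  carrier := {φ | ∀ u, φ u ∈ coinvariantDegree W d}
  add_mem' ha hb u := add_mem (ha u) (hb u)
  zero_mem' _ := zero_mem _
  smul_mem' c _ ha u := Submodule.smul_mem _ c (ha u)

/-- The fake degree `f^U(q) = Hilb(Hom_W(U, S/I), q) = ∑_d dim Hom_W(U, (S/I)_d) q^d`
of a (finite-dimensional) representation `U` of `W`, as a power series in `q = X`. -/
def fakeDegree {W : Subgroup (RealSpace l ≃ₗ[ℝ] RealSpace l)} {U : Type*} [AddCommGroup U]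
    [Module ℂ U] (ρ : Representation ℂ W U) : ℤ⟦X⟧ :=
  PowerSeries.mk fun d => (Module.finrank ℂ (homDegree ρ d) : ℤ)

/-! ### The permutation representation on a root orbit -/

/-- The orbit `Φ' = W α`. -/
abbrev RootOrbit (W : Subgroup (RealSpace l ≃ₗ[ℝ] RealSpace l)) (α : RealSpace l) : Type :=
  MulAction.orbit W α

/-- The permutation representation of `W` on `ℂ[Φ']`. -/
def orbitRep (W : Subgroup (RealSpace l ≃ₗ[ℝ] RealSpace l)) (α : RealSpace l) :
    Representation ℂ W (MonoidAlgebra ℂ (RootOrbit W α)) :=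
  Representation.ofMulAction ℂ W (RootOrbit W α)

theorem IsRootSystem.neg_mem_orbit {W : Subgroup (RealSpace l ≃ₗ[ℝ] RealSpace l)}
    {Φ : Set (RealSpace l)} (hΦ : IsRootSystem W Φ) {α : RealSpace l} (hα : α ∈ Φ)
    {β : RealSpace l} (hβ : β ∈ MulAction.orbit W α) : -β ∈ MulAction.orbit W α := by
  obtain ⟨w, rfl⟩ := hβ
  refine ⟨w * ⟨hyperplaneReflection α, hΦ.reflection_mem α hα⟩, ?_⟩
  have h : hyperplaneReflection α α = -α :=
    Submodule.reflection_orthogonalComplement_singleton_eq_neg α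
  change (w : RealSpace l ≃ₗ[ℝ] RealSpace l) (hyperplaneReflection α α) =
    -(w : RealSpace l ≃ₗ[ℝ] RealSpace l) α
  rw [h, map_neg]

/-- The map `β ↦ -β` of the root orbit `Φ'` to itself. -/
def orbitNeg {W : Subgroup (RealSpace l ≃ₗ[ℝ] RealSpace l)} {Φ : Set (RealSpace l)}
    (hΦ : IsRootSystem W Φ) {α : RealSpace l} (hα : α ∈ Φ) (β : RootOrbit W α) : RootOrbit W α :=
  ⟨-(β : RealSpace l), hΦ.neg_mem_orbit hα β.2⟩

/-- The involution of `ℂ[Φ']` that swaps the basis elements `β` and `-β` for all `β`. -/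
def orbitInvolution {W : Subgroup (RealSpace l ≃ₗ[ℝ] RealSpace l)} {Φ : Set (RealSpace l)}
    (hΦ : IsRootSystem W Φ) {α : RealSpace l} (hα : α ∈ Φ) :
    Module.End ℂ (MonoidAlgebra ℂ (RootOrbit W α)) :=
  (MonoidAlgebra.coeffLinearEquiv ℂ).symm.toLinearMap ∘ₗ
    Finsupp.lmapDomain ℂ ℂ (orbitNeg hΦ hα) ∘ₗ (MonoidAlgebra.coeffLinearEquiv ℂ).toLinearMap

theorem orbitInvolution_comm {W : Subgroup (RealSpace l ≃ₗ[ℝ] RealSpace l)}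
    {Φ : Set (RealSpace l)} (hΦ : IsRootSystem W Φ) {α : RealSpace l} (hα : α ∈ Φ) (w : W)
    (u : MonoidAlgebra ℂ (RootOrbit W α)) :
    orbitInvolution hΦ hα (orbitRep W α w u) = orbitRep W α w (orbitInvolution hΦ hα u) := by
  have h : orbitNeg hΦ hα ∘ (fun β => w • β) = (fun β => w • β) ∘ orbitNeg hΦ hα := by
    funext β
    apply Subtype.ext
    exact (map_neg (w : RealSpace l ≃ₗ[ℝ] RealSpace l) (β : RealSpace l)).symm
  simp only [orbitInvolution, orbitRep, Representation.ofMulAction, MonoidHom.coe_mk,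
    OneHom.coe_mk, LinearMap.comp_apply, LinearEquiv.coe_coe, LinearEquiv.apply_symm_apply,
    Finsupp.lmapDomain_apply, ← Finsupp.mapDomain_comp, h]

/-- The eigenspace of the involution for the eigenvalue `c`, as a subrepresentation of `ℂ[Φ']`. -/
def involutionEigen {W : Subgroup (RealSpace l ≃ₗ[ℝ] RealSpace l)} {Φ : Set (RealSpace l)}
    (hΦ : IsRootSystem W Φ) {α : RealSpace l} (hα : α ∈ Φ) (c : ℂ) :
    Subrepresentation (orbitRep W α) where
  toSubmodule := (orbitInvolution hΦ hα).eigenspace c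
  apply_mem_toSubmodule w u hu := by
    rw [Module.End.mem_eigenspace_iff] at hu ⊢
    rw [orbitInvolution_comm, hu, map_smul]

/-- The symmetric component `ℂ[Φ']^+`. -/
def symmetricPart {W : Subgroup (RealSpace l ≃ₗ[ℝ] RealSpace l)} {Φ : Set (RealSpace l)}
    (hΦ : IsRootSystem W Φ) {α : RealSpace l} (hα : α ∈ Φ) :
    Subrepresentation (orbitRep W α) :=
  involutionEigen hΦ hα 1

/-- The antisymmetric component `ℂ[Φ']^-`. -/
def antisymmetricPart {W : Subgroup (RealSpace l ≃ₗ[ℝ] RealSpace l)} {Φ : Set (RealSpace l)}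
    (hΦ : IsRootSystem W Φ) {α : RealSpace l} (hα : α ∈ Φ) :
    Subrepresentation (orbitRep W α) :=
  involutionEigen hΦ hα (-1)

end ReflFakeDegree

end

noncomputable section

namespace ReflFakeDegree

open MvPolynomial

variable {l : ℕ}

/-! Let `s` be the reflection in `α`, and `L` the linear form of `α`. As `s α = -α`, the
`c`-eigenspace of the swap (`c = ±1`) is generated by `α + c (-α)`. Frobenius reciprocity
(`range_evalGenerator`) identifies the degree `d` equivariant maps from it to `S/I` with the
elements of `(S/I)_d` fixed by the stabilizer of `α` and scaled by `c` under `s`.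

Multiplication by `L` carries the `c = 1` space in degree `d` to the `c = -1` space in degree `d +
1`, since the stabilizer fixes `L` and `s` negates it. It is bijective, by averaging over the
stabilizer and `s`, because a polynomial negated by `s` is divisible by `L`. For surjectivity, a
class lifts to such a polynomial and is divided by `L` (`exists_linForm_mul_eq`). For injectivity,
if `L f` lies in `I`, anti-averaging an expression `∑ a_i g_i` with invariant `g_i` affects only the
`a_i`, each of which becomes divisible by `L`; cancelling `L` puts the average of `f` in `I`
(`charProj_mem`, `eq_zero_of_linForm_mul_eq_zero`). In degree `0` the `c = -1` space vanishes, so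
the antisymmetric series is exactly `q` times the symmetric one. -/

/-! ### Linear forms, isometries and reflections -/

/-- The linear form `x ↦ ⟨v, x⟩` as a polynomial. -/
def linForm (v : RealSpace l) : Poly l := ∑ i, C ((v i : ℝ) : ℂ) * X i

theorem coeff_linForm (v : RealSpace l) (i : Fin l) :
    (linForm v).coeff (Finsupp.single i 1) = (v i : ℂ) := by
  simp [linForm, coeff_sum, coeff_C_mul, MvPolynomial.coeff_X, Finsupp.single_left_inj]

theorem linForm_ne_zero {v : RealSpace l} (hv : v ≠ 0) : linForm v ≠ 0 := by
  intro h
  apply hv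
  ext i
  have := coeff_linForm v i
  rw [h, coeff_zero] at this
  simpa using this.symm

theorem linForm_isHomogeneous (v : RealSpace l) : (linForm v).IsHomogeneous 1 :=
  IsHomogeneous.sum _ _ _ fun i _ => isHomogeneous_C_mul_X _ i

theorem linForm_neg (v : RealSpace l) : linForm (-v) = -linForm v := by
  simp [linForm]

theorem polyAction_X (g : RealSpace l ≃ₗ[ℝ] RealSpace l) (i : Fin l) :
    polyAction l g (X i) = coordComp g i := by
  simp [polyAction]

theorem polyAction_isHomogeneous (g : RealSpace l ≃ₗ[ℝ] RealSpace l) {f : Poly l} {d : ℕ}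
    (hf : f.IsHomogeneous d) : (polyAction l g f).IsHomogeneous d := by
  have h := hf.aeval (coordComp g) (n := 1) fun i =>
    IsHomogeneous.sum _ _ _ fun j _ => isHomogeneous_C_mul_X _ j
  rwa [one_mul] at h

/-- A linear automorphism preserving the inner product. -/
def PreservesInner (g : RealSpace l ≃ₗ[ℝ] RealSpace l) : Prop :=
  ∀ x y, inner ℝ (g x) (g y) = inner ℝ x y

theorem preservesInner_hyperplaneReflection (v : RealSpace l) :
    PreservesInner (hyperplaneReflection v) :=
  fun x y => ((Submodule.span ℝ {v})ᗮ.reflection).inner_map_map x y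

theorem IsFiniteReflectionGroup.preservesInner
    {W : Subgroup (RealSpace l ≃ₗ[ℝ] RealSpace l)} (hW : IsFiniteReflectionGroup W)
    {g : RealSpace l ≃ₗ[ℝ] RealSpace l} (hg : g ∈ W) : PreservesInner g := by
  rw [← hW.generated] at hg
  induction hg using Subgroup.closure_induction with
  | mem s hs =>
    obtain ⟨-, v, -, rfl⟩ := hs
    exact preservesInner_hyperplaneReflection v
  | one => exact fun _ _ => rfl
  | mul a b _ _ ha hb => exact fun x y => (ha _ _).trans (hb x y)
  | inv a _ ha =>
    intro x y
    have h := ha (a⁻¹ x) (a⁻¹ y)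
    rwa [← LinearEquiv.mul_apply, ← LinearEquiv.mul_apply, mul_inv_cancel, eq_comm] at h

/-- For an isometry, `g⁻¹` is the adjoint of `g`, so substituting `g⁻¹ x` into `⟨v, x⟩` moves `g`
onto `v`. -/
theorem polyAction_linForm {g : RealSpace l ≃ₗ[ℝ] RealSpace l} (hg : PreservesInner g)
    (v : RealSpace l) : polyAction l g (linForm v) = linForm (g v) := by
  have key : ∀ j, ∑ i, v i * g⁻¹ (EuclideanSpace.single j (1 : ℝ)) i = g v j := by
    intro j
    have h := hg v (g⁻¹ (EuclideanSpace.single j (1 : ℝ)))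
    rw [← LinearEquiv.mul_apply, mul_inv_cancel] at h
    rw [LinearEquiv.coe_one, id, EuclideanSpace.inner_single_right, PiLp.inner_apply] at h
    simp only [one_mul, conj_trivial, RCLike.inner_apply] at h
    rw [h]
    exact Finset.sum_congr rfl fun i _ => mul_comm _ _
  simp only [linForm, map_sum, map_mul, algHom_C, algebraMap_eq, polyAction_X, coordComp,
    Finset.mul_sum]
  rw [Finset.sum_comm]
  refine Finset.sum_congr rfl fun j _ => ?_
  rw [← key j]
  push_cast
  simp only [map_sum, map_mul, Finset.sum_mul, mul_assoc]

theorem hyperplaneReflection_apply (v x : RealSpace l) :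
    hyperplaneReflection v x = x - (2 * (inner ℝ v x / ‖v‖ ^ 2)) • v := by
  change (Submodule.span ℝ {v})ᗮ.reflection x = _
  rw [Submodule.reflection_orthogonal_apply, Submodule.reflection_singleton_apply]
  simp [mul_smul, two_smul]

theorem hyperplaneReflection_self (v : RealSpace l) : hyperplaneReflection v v = -v :=
  Submodule.reflection_orthogonalComplement_singleton_eq_neg v

theorem hyperplaneReflection_mul_self (v : RealSpace l) :
    hyperplaneReflection v * hyperplaneReflection v = 1 :=
  LinearEquiv.ext fun x => by
    rw [LinearEquiv.mul_apply]
    exact Submodule.reflection_reflection (Submodule.span ℝ {v})ᗮ x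

theorem hyperplaneReflection_inv (v : RealSpace l) :
    (hyperplaneReflection v)⁻¹ = hyperplaneReflection v :=
  inv_eq_of_mul_eq_one_left (hyperplaneReflection_mul_self v)

theorem hyperplaneReflection_commute {g : RealSpace l ≃ₗ[ℝ] RealSpace l} (hg : PreservesInner g)
    {v : RealSpace l} (hv : g v = v) :
    g * hyperplaneReflection v = hyperplaneReflection v * g := by
  refine LinearEquiv.ext fun x => ?_
  have h := hg v x
  rw [hv] at h
  rw [LinearEquiv.mul_apply, LinearEquiv.mul_apply, hyperplaneReflection_apply,
    hyperplaneReflection_apply, map_sub, map_smul, hv, h]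

/-- The reflection fixes its hyperplane pointwise, hence acts trivially modulo the linear form. Both
sides are algebra maps, so the variables suffice. -/
theorem linForm_dvd_sub_reflection (v : RealSpace l) (f : Poly l) :
    linForm v ∣ f - polyAction l (hyperplaneReflection v) f := by
  have h : (Ideal.Quotient.mkₐ ℂ (Ideal.span {linForm v})).comp
      (polyAction l (hyperplaneReflection v)) = Ideal.Quotient.mkₐ ℂ (Ideal.span {linForm v}) := by
    ext1 i
    rw [AlgHom.comp_apply, polyAction_X, eq_comm, Ideal.Quotient.mkₐ_eq_mk, Ideal.Quotient.eq,
      Ideal.mem_span_singleton]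
    -- The reflection formula gives `x_i - s x_i = (2 v_i / ‖v‖²) ⟨v, x⟩`.
    refine ⟨C ((2 * (v i / ‖v‖ ^ 2) : ℝ) : ℂ), ?_⟩
    have hX : (X i : Poly l) = ∑ j, C (((EuclideanSpace.single j (1 : ℝ)) i : ℝ) : ℂ) * X j := by
      simp [apply_ite, ite_mul]
    rw [hX, coordComp, linForm, ← Finset.sum_sub_distrib, Finset.sum_mul, hyperplaneReflection_inv]
    refine Finset.sum_congr rfl fun j _ => ?_
    rw [hyperplaneReflection_apply, ← sub_mul, ← map_sub, mul_right_comm, ← map_mul]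
    congr 2
    rw [EuclideanSpace.inner_single_right]
    simp only [PiLp.sub_apply, PiLp.smul_apply, smul_eq_mul]
    push_cast
    simp
    ring
  rw [← Ideal.mem_span_singleton, ← Ideal.Quotient.eq]
  exact (DFunLike.congr_fun h f).symm

theorem linForm_dvd_of_reflection_eq_neg {v : RealSpace l} {f : Poly l}
    (hf : polyAction l (hyperplaneReflection v) f = -f) : linForm v ∣ f := by
  have h := linForm_dvd_sub_reflection v f
  rw [hf, sub_neg_eq_add, ← two_mul] at h
  have h2 := h.mul_left (C (1 / 2 : ℂ))
  rw [← mul_assoc, show (2 : Poly l) = C 2 from (map_ofNat C 2).symm, ← C_mul] at h2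
  simpa using h2

theorem homogeneousComponent_linForm_mul (v : RealSpace l) (f : Poly l) (d : ℕ) :
    homogeneousComponent (d + 1) (linForm v * f) = linForm v * homogeneousComponent d f := by
  let _ : GradedAlgebra (homogeneousSubmodule (Fin l) ℂ) := gradedAlgebra
  have h := DirectSum.coe_decompose_mul_add_of_left_mem (homogeneousSubmodule (Fin l) ℂ) (j := d)
    (b := f) ((mem_homogeneousSubmodule 1 _).2 (linForm_isHomogeneous v))
  rw [add_comm] at h
  rw [← decomposition.decompose'_apply, ← decomposition.decompose'_apply]
  exact h

/-! ### Averaging polynomials over the stabilizer and the reflection -/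

section Projection

variable (W : Subgroup (RealSpace l ≃ₗ[ℝ] RealSpace l)) (α : RealSpace l)
  [Fintype (MulAction.stabilizer W α)]

/-- The sum `∑ (w + c s w)` over the stabilizer of `α`, with `s` the reflection in `α`. For
`c = ±1` it is a multiple of the projection of `S` to the `w ↦ 1`, `s ↦ c` isotypic part. -/
def charProj (c : ℂ) (f : Poly l) : Poly l :=
  ∑ w : MulAction.stabilizer W α, (polyAction l w f +
    c • polyAction l (hyperplaneReflection α) (polyAction l w f))

variable {W α}

theorem polyAction_reflection_reflection (f : Poly l) :
    polyAction l (hyperplaneReflection α) (polyAction l (hyperplaneReflection α) f) = f := by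
  rw [← AlgHom.mul_apply, ← map_mul, hyperplaneReflection_mul_self, map_one, AlgHom.one_apply]

theorem reflection_charProj {c : ℂ} (hc : c * c = 1) (f : Poly l) :
    polyAction l (hyperplaneReflection α) (charProj W α c f) = c • charProj W α c f := by
  simp only [charProj, map_sum, Finset.smul_sum]
  refine Finset.sum_congr rfl fun w _ => ?_
  rw [map_add, map_smul, polyAction_reflection_reflection, smul_add, smul_smul, hc, one_smul,
    add_comm]

/-- An element fixing `α` commutes with `s`, so it only permutes the summands. -/
theorem stabilizer_charProj (hW : ∀ g ∈ W, PreservesInner g) (c : ℂ) (f : Poly l) {w : W}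
    (hw : (w : RealSpace l ≃ₗ[ℝ] RealSpace l) α = α) :
    polyAction l w (charProj W α c f) = charProj W α c f := by
  simp only [charProj, map_sum]
  refine Fintype.sum_equiv (Equiv.mulLeft (⟨w, hw⟩ : MulAction.stabilizer W α)) _ _ fun u => ?_
  have hu : polyAction l (((Equiv.mulLeft (⟨w, hw⟩ : MulAction.stabilizer W α)) u : W) :
      RealSpace l ≃ₗ[ℝ] RealSpace l) = polyAction l w * polyAction l (u : W) := by
    rw [← map_mul]; rfl
  have hs : polyAction l w * polyAction l (hyperplaneReflection α) =
      polyAction l (hyperplaneReflection α) * polyAction l w := by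
    rw [← map_mul, ← map_mul, hyperplaneReflection_commute (hW w w.2) hw]
  rw [hu, map_add, map_smul, AlgHom.mul_apply, ← AlgHom.mul_apply, ← AlgHom.mul_apply, hs]
  rfl

theorem charProj_isHomogeneous {c : ℂ} {f : Poly l} {d : ℕ} (hf : f.IsHomogeneous d) :
    (charProj W α c f).IsHomogeneous d := by
  rw [← mem_homogeneousSubmodule]
  refine Submodule.sum_mem _ fun w _ => add_mem ?_ (Submodule.smul_mem _ _ ?_)
  · exact polyAction_isHomogeneous _ hf
  · exact polyAction_isHomogeneous _ (polyAction_isHomogeneous _ hf)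

theorem charProj_add (c : ℂ) (f g : Poly l) :
    charProj W α c (f + g) = charProj W α c f + charProj W α c g := by
  simp only [charProj, map_add, smul_add, ← Finset.sum_add_distrib]
  exact Finset.sum_congr rfl fun w _ => by abel

theorem charProj_mul_of_invariant (c : ℂ) (f g : Poly l)
    (hg : ∀ w ∈ W, polyAction l w g = g) (hα : hyperplaneReflection α ∈ W) :
    charProj W α c (f * g) = charProj W α c f * g := by
  simp only [charProj, Finset.sum_mul]
  refine Finset.sum_congr rfl fun w _ => ?_
  rw [map_mul, map_mul, hg _ w.1.2, hg _ hα, add_mul, smul_mul_assoc]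

/-- The sign from `s α = -α` exchanges the characters `1` and `-1` of `s`. -/
theorem charProj_linForm_mul (hW : ∀ g ∈ W, PreservesInner g) (f : Poly l) :
    charProj W α (-1) (linForm α * f) = linForm α * charProj W α 1 f := by
  simp only [charProj, Finset.mul_sum]
  refine Finset.sum_congr rfl fun w _ => ?_
  have hw : (w : RealSpace l ≃ₗ[ℝ] RealSpace l) α = α := w.2
  rw [map_mul, map_mul, polyAction_linForm (hW _ w.1.2), hw,
    polyAction_linForm (preservesInner_hyperplaneReflection α), hyperplaneReflection_self,
    linForm_neg]
  simp only [neg_smul, one_smul]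
  ring

theorem linForm_dvd_charProj (f : Poly l) : linForm α ∣ charProj W α (-1) f :=
  linForm_dvd_of_reflection_eq_neg (by rw [reflection_charProj (by norm_num), neg_one_smul])

/-- Projection is linear over the invariants that generate the ideal, so it acts on the coefficients
alone and makes each divisible by the linear form. The quotient therefore stays in the ideal. -/
theorem charProj_mem (hα : hyperplaneReflection α ∈ W) {f : Poly l}
    (hf : f ∈ invariantIdeal W) : ∃ k ∈ invariantIdeal W, charProj W α (-1) f = linForm α * k := by
  -- An arbitrary multiplier `a` lets the induction absorb the coefficients of the span.
  suffices h : ∀ a, ∃ k ∈ invariantIdeal W, charProj W α (-1) (a * f) = linForm α * k by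
    simpa using h 1
  induction hf using Submodule.span_induction with
  | zero => exact fun _ => ⟨0, zero_mem _, by simp [charProj]⟩
  | mem x hx =>
    intro a
    obtain ⟨k, hk⟩ := linForm_dvd_charProj (W := W) (α := α) a
    refine ⟨k * x, Ideal.mul_mem_left _ _ (Ideal.subset_span hx), ?_⟩
    rw [charProj_mul_of_invariant _ _ _ hx.1 hα, hk, mul_assoc]
  | add x y _ _ hx hy =>
    intro a
    obtain ⟨k, hk, h⟩ := hx a
    obtain ⟨k', hk', h'⟩ := hy a
    exact ⟨k + k', add_mem hk hk', by rw [mul_add, charProj_add, h, h', mul_add]⟩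
  | smul b x _ hx =>
    intro a
    rw [smul_eq_mul, ← mul_assoc]
    exact hx (a * b)

end Projection

/-! ### Multiplication by the root on semi-invariants of the coinvariant algebra -/

/-- The degree `d` elements of the coinvariant algebra that are fixed by the stabilizer of `α` and
on which `s` acts as `c`. -/
def semiInvariants {W : Subgroup (RealSpace l ≃ₗ[ℝ] RealSpace l)} (α : RealSpace l) (s : W) (c : ℂ)
    (d : ℕ) : Submodule ℂ (Coinvariant W) where
  carrier := {x | x ∈ coinvariantDegree W d ∧
    (∀ w : W, (w : RealSpace l ≃ₗ[ℝ] RealSpace l) α = α → coinvariantRep W w x = x) ∧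
    coinvariantRep W s x = c • x}
  add_mem' ha hb := ⟨add_mem ha.1 hb.1, fun w hw => by rw [map_add, ha.2.1 w hw, hb.2.1 w hw],
    by rw [map_add, ha.2.2, hb.2.2, smul_add]⟩
  zero_mem' := ⟨zero_mem _, fun w _ => map_zero _, by rw [map_zero, smul_zero]⟩
  smul_mem' a x hx := ⟨Submodule.smul_mem _ _ hx.1,
    fun w hw => by rw [map_smul, hx.2.1 w hw], by rw [map_smul, hx.2.2, smul_comm]⟩

section Coinvariant

variable {W : Subgroup (RealSpace l ≃ₗ[ℝ] RealSpace l)} {α : RealSpace l} {s : W}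

theorem coinvariantRep_mk (w : W) (f : Poly l) :
    coinvariantRep W w (Ideal.Quotient.mk _ f) = Ideal.Quotient.mk _ (polyAction l w f) := rfl

theorem coinvariantRep_mul (w : W) (x y : Coinvariant W) :
    coinvariantRep W w (x * y) = coinvariantRep W w x * coinvariantRep W w y := by
  obtain ⟨f, rfl⟩ := Ideal.Quotient.mk_surjective x
  obtain ⟨g, rfl⟩ := Ideal.Quotient.mk_surjective y
  rw [← map_mul, coinvariantRep_mk, map_mul, map_mul, coinvariantRep_mk, coinvariantRep_mk]

/-- On a semi-invariant class each stabilizer element contributes `x + c² x = 2 x`. -/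
theorem mk_charProj [Fintype (MulAction.stabilizer W α)] (hs : s.1 = hyperplaneReflection α)
    {c : ℂ} (hc : c * c = 1) {d : ℕ} {f : Poly l}
    (hf : Ideal.Quotient.mk _ f ∈ semiInvariants α s c d) :
    (Ideal.Quotient.mk _ (charProj W α c f) : Coinvariant W) =
      (2 * Fintype.card (MulAction.stabilizer W α) : ℂ) • Ideal.Quotient.mk _ f := by
  have h : ∀ w : MulAction.stabilizer W α, (Ideal.Quotient.mk _ (polyAction l w f +
      c • polyAction l (hyperplaneReflection α) (polyAction l w f)) : Coinvariant W) =
      (2 : ℂ) • Ideal.Quotient.mk _ f := by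
    intro w
    have hc' (p : Poly l) : (Ideal.Quotient.mk (invariantIdeal W) (c • p)) =
      c • Ideal.Quotient.mk (invariantIdeal W) p := rfl
    rw [map_add, hc', ← hs, ← coinvariantRep_mk, ← coinvariantRep_mk,
      hf.2.1 w.1 w.2, ← coinvariantRep_mk,
      hf.2.1 w.1 w.2, hf.2.2, smul_smul, hc, one_smul, two_smul]
  rw [charProj, map_sum, Finset.sum_congr rfl fun w _ => h w, Finset.sum_const, Finset.card_univ,
    mul_comm, mul_smul, Nat.cast_smul_eq_nsmul]

theorem exists_isHomogeneous_mk {d : ℕ} {x : Coinvariant W} (hx : x ∈ coinvariantDegree W d) :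
    ∃ f : Poly l, f.IsHomogeneous d ∧ Ideal.Quotient.mk _ f = x := by
  obtain ⟨f, hf, rfl⟩ := hx
  exact ⟨f, hf, rfl⟩

theorem card_ne_zero [Fintype (MulAction.stabilizer W α)] :
    (2 * Fintype.card (MulAction.stabilizer W α) : ℂ) ≠ 0 :=
  mul_ne_zero two_ne_zero (Nat.cast_ne_zero.2 Fintype.card_ne_zero)

theorem linForm_mul_mem (hW : ∀ g ∈ W, PreservesInner g) (hs : s.1 = hyperplaneReflection α)
    {d : ℕ} {x : Coinvariant W} (hx : x ∈ semiInvariants α s 1 d) :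
    Ideal.Quotient.mk _ (linForm α) * x ∈ semiInvariants α s (-1) (d + 1) := by
  refine ⟨?_, fun w hw => ?_, ?_⟩
  · obtain ⟨f, hf, rfl⟩ := exists_isHomogeneous_mk hx.1
    rw [add_comm]
    exact ⟨linForm α * f, (linForm_isHomogeneous α).mul hf, map_mul (Ideal.Quotient.mk _) _ _⟩
  · rw [coinvariantRep_mul, hx.2.1 w hw, coinvariantRep_mk, polyAction_linForm (hW _ w.2), hw]
  · rw [coinvariantRep_mul, hx.2.2, coinvariantRep_mk, polyAction_linForm (hW _ s.2), hs,
      hyperplaneReflection_self, linForm_neg, map_neg, one_smul, neg_one_smul]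
    exact neg_mul (Ideal.Quotient.mk (invariantIdeal W) (linForm α)) x

theorem eq_zero_of_linForm_mul_eq_zero [Finite W] (hW : ∀ g ∈ W, PreservesInner g)
    (hα : α ≠ 0) (hs : s.1 = hyperplaneReflection α)
    {d : ℕ} {x : Coinvariant W} (hx : x ∈ semiInvariants α s 1 d)
    (h : Ideal.Quotient.mk _ (linForm α) * x = 0) : x = 0 := by
  have := Fintype.ofFinite (MulAction.stabilizer W α)
  obtain ⟨f, rfl⟩ := Ideal.Quotient.mk_surjective x
  rw [← map_mul, Ideal.Quotient.eq_zero_iff_mem] at h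
  -- Cancelling the linear form identifies `charProj W α 1 f` with `k`, an element of the ideal;
  -- modulo the ideal it is a nonzero multiple of `f`.
  obtain ⟨k, hk, hfk⟩ := charProj_mem (hs ▸ s.2) h
  rw [charProj_linForm_mul hW] at hfk
  rw [← mul_left_cancel₀ (linForm_ne_zero hα) hfk, ← Ideal.Quotient.eq_zero_iff_mem,
    mk_charProj hs (one_mul 1) hx] at hk
  exact (smul_eq_zero.1 hk).resolve_left card_ne_zero

theorem exists_linForm_mul_eq [Finite W] (hW : ∀ g ∈ W, PreservesInner g)
    (hα : α ≠ 0) (hs : s.1 = hyperplaneReflection α)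
    {d : ℕ} {x : Coinvariant W} (hx : x ∈ semiInvariants α s (-1) (d + 1)) :
    ∃ y ∈ semiInvariants α s 1 d, Ideal.Quotient.mk _ (linForm α) * y = x := by
  have := Fintype.ofFinite (MulAction.stabilizer W α)
  obtain ⟨f, hf, rfl⟩ := exists_isHomogeneous_mk hx.1
  have hL := linForm_ne_zero hα
  have hP := mk_charProj hs (by norm_num) hx
  obtain ⟨k, hk⟩ := linForm_dvd_charProj (W := W) (α := α) f
  -- Comparing components of degree `d + 1` and cancelling the linear form shows that `k` is its own
  -- degree `d` component.
  have hkd : k.IsHomogeneous d := by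
    have h := homogeneousComponent_linForm_mul α k d
    rw [← hk, homogeneousComponent_eq_self (charProj_isHomogeneous hf), hk] at h
    rw [mul_left_cancel₀ hL h]
    exact homogeneousComponent_isHomogeneous _ _
  have hkw : ∀ w : W, (w : RealSpace l ≃ₗ[ℝ] RealSpace l) α = α → polyAction l w k = k := by
    intro w hw
    have h := stabilizer_charProj hW (-1) f hw
    rw [hk, map_mul, polyAction_linForm (hW _ w.2), hw] at h
    exact mul_left_cancel₀ hL h
  have hks : polyAction l s k = k := by
    have h := reflection_charProj (W := W) (α := α) (c := -1) (by norm_num) f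
    rw [hk, map_mul, polyAction_linForm (preservesInner_hyperplaneReflection α),
      hyperplaneReflection_self, linForm_neg, neg_one_smul, neg_mul, neg_inj] at h
    rw [hs]
    exact mul_left_cancel₀ hL h
  -- The scalar undoes the factor by which averaging multiplies the class of `f`.
  refine ⟨(2 * Fintype.card (MulAction.stabilizer W α) : ℂ)⁻¹ • Ideal.Quotient.mk _ k,
    Submodule.smul_mem _ _ ⟨⟨k, hkd, rfl⟩, fun w hw => ?_, ?_⟩, ?_⟩
  · rw [coinvariantRep_mk, hkw w hw]
  · rw [coinvariantRep_mk, hks, one_smul]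
  · rw [mul_smul_comm, ← map_mul, ← hk, hP, inv_smul_smul₀ card_ne_zero]

/-- Constants are fixed by `s`, so being negated forces them to vanish. -/
theorem semiInvariants_neg_one_zero :
    semiInvariants α s (-1) 0 = ⊥ := by
  rw [eq_bot_iff]
  intro x hx
  obtain ⟨f, hf, rfl⟩ := exists_isHomogeneous_mk hx.1
  rw [← totalDegree_zero_iff_isHomogeneous, totalDegree_eq_zero_iff_eq_C] at hf
  have h := hx.2.2
  rw [coinvariantRep_mk, hf, algHom_C, algebraMap_eq, neg_one_smul, eq_neg_iff_add_eq_zero,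
    ← two_smul ℂ] at h
  rw [hf]
  exact (smul_eq_zero.1 h).resolve_left two_ne_zero

theorem finrank_semiInvariants_succ [Finite W] (hW : ∀ g ∈ W, PreservesInner g)
    (hα : α ≠ 0) (hs : s.1 = hyperplaneReflection α) (d : ℕ) :
    Module.finrank ℂ (semiInvariants α s (-1) (d + 1)) =
      Module.finrank ℂ (semiInvariants α s 1 d) := by
  refine (LinearEquiv.finrank_eq (LinearEquiv.ofBijective
    ((LinearMap.mulLeft ℂ (Ideal.Quotient.mk _ (linForm α) : Coinvariant W)).restrict
      fun x hx => linForm_mul_mem hW hs hx) ⟨?_, ?_⟩)).symm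
  · rw [injective_iff_map_eq_zero]
    intro x hx
    exact Subtype.ext (eq_zero_of_linForm_mul_eq_zero hW hα hs x.2 (congrArg Subtype.val hx))
  · intro x
    obtain ⟨y, hy, h⟩ := exists_linForm_mul_eq hW hα hs x.2
    exact ⟨⟨y, hy⟩, Subtype.ext h⟩

end Coinvariant

/-! ### Eigenspaces of the swap on the root orbit -/

variable {W : Subgroup (RealSpace l ≃ₗ[ℝ] RealSpace l)} {Φ : Set (RealSpace l)}
  (hΦ : IsRootSystem W Φ) {α : RealSpace l} (hα : α ∈ Φ)

theorem orbitNeg_orbitNeg (β : RootOrbit W α) : orbitNeg hΦ hα (orbitNeg hΦ hα β) = β :=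
  Subtype.ext (neg_neg _)

theorem orbitInvolution_single (β : RootOrbit W α) (a : ℂ) :
    orbitInvolution hΦ hα (.single β a) = .single (orbitNeg hΦ hα β) a := by
  simp [orbitInvolution]

theorem orbitInvolution_orbitInvolution (u : MonoidAlgebra ℂ (RootOrbit W α)) :
    orbitInvolution hΦ hα (orbitInvolution hΦ hα u) = u := by
  suffices h : orbitInvolution hΦ hα ∘ₗ orbitInvolution hΦ hα = LinearMap.id from
    DFunLike.congr_fun h u
  ext β : 2
  simp [orbitInvolution_single, orbitNeg_orbitNeg]

theorem add_smul_orbitInvolution_mem {c : ℂ} (hc : c * c = 1)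
    (u : MonoidAlgebra ℂ (RootOrbit W α)) :
    u + c • orbitInvolution hΦ hα u ∈ (involutionEigen hΦ hα c).toSubmodule := by
  refine Module.End.mem_eigenspace_iff.2 ?_
  rw [map_add, map_smul, orbitInvolution_orbitInvolution, smul_add, smul_smul, hc, one_smul,
    add_comm]

/-- The map `u ↦ u + c T u` onto the eigenspace of the involution `T` for `c = ±1`. -/
def eigenMap {c : ℂ} (hc : c * c = 1) :
    MonoidAlgebra ℂ (RootOrbit W α) →ₗ[ℂ] (involutionEigen hΦ hα c).toSubmodule :=
  (LinearMap.id + c • orbitInvolution hΦ hα).codRestrict _ (add_smul_orbitInvolution_mem hΦ hα hc)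

theorem eigenMap_coe {c : ℂ} (hc : c * c = 1) (u : MonoidAlgebra ℂ (RootOrbit W α)) :
    (eigenMap hΦ hα hc u : MonoidAlgebra ℂ (RootOrbit W α)) = u + c • orbitInvolution hΦ hα u :=
  rfl

theorem eigenMap_apply_coe {c : ℂ} (hc : c * c = 1)
    (u : (involutionEigen hΦ hα c).toSubmodule) : eigenMap hΦ hα hc u = (2 : ℂ) • u := by
  refine Subtype.ext ?_
  have hu : orbitInvolution hΦ hα u = c • u := Module.End.mem_eigenspace_iff.1 u.2
  rw [eigenMap_coe, hu, smul_smul, hc, one_smul, ← two_smul ℂ]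
  rfl

theorem eigenMap_orbitRep {c : ℂ} (hc : c * c = 1) (w : W)
    (u : MonoidAlgebra ℂ (RootOrbit W α)) :
    eigenMap hΦ hα hc (orbitRep W α w u) =
      (involutionEigen hΦ hα c).toRepresentation w (eigenMap hΦ hα hc u) := by
  refine Subtype.ext ?_
  rw [eigenMap_coe, orbitInvolution_comm]
  change _ = orbitRep W α w (u + c • orbitInvolution hΦ hα u)
  rw [map_add, map_smul]

/-! ### Frobenius reciprocity for the eigenspaces -/

/-- The root `α` as an element of its orbit. -/
def baseRoot (W : Subgroup (RealSpace l ≃ₗ[ℝ] RealSpace l)) (α : RealSpace l) : RootOrbit W α :=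
  ⟨α, MulAction.mem_orbit_self α⟩

theorem orbitRep_single (w : W) (β : RootOrbit W α) (a : ℂ) :
    orbitRep W α w (.single β a) = .single (w • β) a :=
  Representation.ofMulAction_single w β a

theorem exists_smul_baseRoot (β : RootOrbit W α) : ∃ w : W, w • baseRoot W α = β := by
  obtain ⟨w, hw⟩ := β.2
  exact ⟨w, Subtype.ext hw⟩

/-- The equivariant map `ℂ[Φ'] → S/I` that sends `α` to an element fixed by the stabilizer. -/
theorem exists_intertwining {x : Coinvariant W}
    (hx : ∀ w : W, (w : RealSpace l ≃ₗ[ℝ] RealSpace l) α = α → coinvariantRep W w x = x) :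
    ∃ φ : Representation.IntertwiningMap (orbitRep W α) (coinvariantRep W),
      ∀ w : W, φ (.single (w • baseRoot W α) 1) = coinvariantRep W w x := by
  choose g hg using exists_smul_baseRoot (W := W) (α := α)
  let ψ : MonoidAlgebra ℂ (RootOrbit W α) →ₗ[ℂ] Coinvariant W :=
    Finsupp.linearCombination ℂ (fun β => coinvariantRep W (g β) x) ∘ₗ
      (MonoidAlgebra.coeffLinearEquiv ℂ).toLinearMap
  have hψ (w : W) : ψ (.single (w • baseRoot W α) 1) = coinvariantRep W w x := by
    have h1 : ψ (.single (w • baseRoot W α) 1) =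
        coinvariantRep W (g (w • baseRoot W α)) x := by simp [ψ]
    rw [h1]
    -- Independence of the chosen representative: two elements carrying `α` to the same root differ
    -- by the stabilizer, which fixes `x`.
    have h2 := hx (w⁻¹ * g (w • baseRoot W α)) (congrArg Subtype.val
      (show (w⁻¹ * g (w • baseRoot W α)) • baseRoot W α = baseRoot W α by
        rw [mul_smul, hg, inv_smul_smul]))
    conv_rhs => rw [← h2]
    rw [← Module.End.mul_apply, ← map_mul, mul_inv_cancel_left]
  refine ⟨⟨ψ, fun w => ?_⟩, hψ⟩
  ext β : 2
  obtain ⟨v, rfl⟩ := exists_smul_baseRoot β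
  simp only [LinearMap.comp_apply, MonoidAlgebra.lsingle_apply, orbitRep_single]
  rw [hψ, ← mul_smul, hψ, map_mul]
  rfl

/-- Evaluation of an equivariant map at `α + c (-α)`. -/
def evalGenerator {c : ℂ} (hc : c * c = 1) (d : ℕ) :
    homDegree (involutionEigen hΦ hα c).toRepresentation d →ₗ[ℂ] Coinvariant W where
  toFun φ := φ.1 (eigenMap hΦ hα hc (.single (baseRoot W α) 1))
  map_add' _ _ := rfl
  map_smul' _ _ := rfl

/-- The translates of `α + c (-α)` span the eigenspace: they are the images of the basis under
`eigenMap`, which is multiplication by `2` there. -/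
theorem evalGenerator_injective {c : ℂ} (hc : c * c = 1) (d : ℕ) :
    Function.Injective (evalGenerator hΦ hα hc d) := by
  rw [injective_iff_map_eq_zero]
  intro φ hφ
  have h : φ.1.toLinearMap ∘ₗ eigenMap hΦ hα hc = 0 := by
    ext β : 2
    obtain ⟨w, rfl⟩ := exists_smul_baseRoot β
    simp only [LinearMap.comp_apply, MonoidAlgebra.lsingle_apply]
    rw [← orbitRep_single, eigenMap_orbitRep, Representation.IntertwiningMap.toLinearMap_apply,
      φ.1.isIntertwining]
    exact (congrArg (coinvariantRep W w) hφ).trans (map_zero _)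
  refine Subtype.ext (Representation.IntertwiningMap.ext (LinearMap.ext fun u => ?_))
  have hu := DFunLike.congr_fun h (u : MonoidAlgebra ℂ (RootOrbit W α))
  rw [LinearMap.comp_apply, eigenMap_apply_coe, map_smul] at hu
  exact (smul_eq_zero.1 hu).resolve_left two_ne_zero

theorem coinvariantRep_mem_degree (w : W) {d : ℕ} {x : Coinvariant W}
    (hx : x ∈ coinvariantDegree W d) : coinvariantRep W w x ∈ coinvariantDegree W d := by
  obtain ⟨f, hf, rfl⟩ := exists_isHomogeneous_mk hx
  exact ⟨_, polyAction_isHomogeneous _ hf, rfl⟩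

theorem range_evalGenerator {s : W} (hs : s.1 = hyperplaneReflection α) {c : ℂ} (hc : c * c = 1)
    (d : ℕ) : LinearMap.range (evalGenerator hΦ hα hc d) = semiInvariants α s c d := by
  -- At the base root the swap agrees with `s`; this turns the eigenvalue `c` into the action of `s`
  -- on the value.
  have hsα : s • baseRoot W α = orbitNeg hΦ hα (baseRoot W α) := by
    refine Subtype.ext ?_
    change s.1 α = -α
    rw [hs, hyperplaneReflection_self]
  apply le_antisymm
  · rintro _ ⟨φ, rfl⟩
    refine ⟨φ.2 _, fun w hw => ?_, ?_⟩
    · change coinvariantRep W w (φ.1 _) = φ.1 _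
      rw [← φ.1.isIntertwining, ← eigenMap_orbitRep, orbitRep_single]
      congr 4
      exact Subtype.ext hw
    · change coinvariantRep W s (φ.1 _) = c • φ.1 _
      rw [← φ.1.isIntertwining, ← eigenMap_orbitRep, orbitRep_single, ← map_smul, hsα]
      congr 1
      refine Subtype.ext ?_
      rw [eigenMap_coe, Submodule.coe_smul, eigenMap_coe, orbitInvolution_single,
        orbitInvolution_single, orbitNeg_orbitNeg, smul_add, smul_smul, hc, one_smul, add_comm]
  · intro x hx
    obtain ⟨φ, hφ⟩ := exists_intertwining hx.2.1
    have hφd (u) : φ u ∈ coinvariantDegree W d := by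
      suffices h : ⊤ ≤ (coinvariantDegree W d).comap φ.toLinearMap from
        h (Submodule.mem_top (x := u))
      intro u _
      induction u using MonoidAlgebra.induction_linear with
      | zero => exact zero_mem _
      | add a b ha hb => exact add_mem (ha trivial) (hb trivial)
      | single β a =>
        obtain ⟨w, rfl⟩ := exists_smul_baseRoot β
        have h : MonoidAlgebra.single (w • baseRoot W α) a =
          a • MonoidAlgebra.single (w • baseRoot W α) 1 := by simp
        rw [h]
        refine Submodule.smul_mem _ _ ?_
        change φ _ ∈ coinvariantDegree W d
        rw [hφ]
        exact coinvariantRep_mem_degree w hx.1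
    let ψ : Representation.IntertwiningMap (involutionEigen hΦ hα c).toRepresentation
        (coinvariantRep W) :=
      ⟨φ.toLinearMap ∘ₗ (involutionEigen hΦ hα c).toSubmodule.subtype, fun w =>
        LinearMap.ext fun u => φ.isIntertwining _ _ w u⟩
    -- The map sending `α` to `x` takes `α + c (-α)` to `x + c (s x) = 2 x`, hence the half.
    refine ⟨(2 : ℂ)⁻¹ • ⟨ψ, fun u => hφd _⟩, ?_⟩
    rw [map_smul, inv_smul_eq_iff₀ two_ne_zero]
    change φ (MonoidAlgebra.single (baseRoot W α) 1 +
      c • orbitInvolution hΦ hα (.single (baseRoot W α) 1)) = _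
    have h1 := hφ 1
    rw [one_smul, map_one] at h1
    rw [orbitInvolution_single, map_add, map_smul, ← hsα, hφ, h1, hx.2.2, smul_smul, hc, one_smul,
      two_smul]
    rfl

theorem finrank_homDegree_involutionEigen {s : W} (hs : s.1 = hyperplaneReflection α) {c : ℂ}
    (hc : c * c = 1) (d : ℕ) :
    Module.finrank ℂ (homDegree (involutionEigen hΦ hα c).toRepresentation d) =
      Module.finrank ℂ (semiInvariants α s c d) := by
  rw [← range_evalGenerator hΦ hα hs hc d,
    LinearMap.finrank_range_of_inj (evalGenerator_injective hΦ hα hc d)]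

instance (d : ℕ) : Module.Finite ℂ (coinvariantDegree W d) := by
  have : Module.Finite ℂ (homogeneousSubmodule (Fin l) ℂ d) :=
    Module.Finite.iff_fg.2 (homogeneousSubmodule_fg ..)
  exact Module.Finite.map _ _

theorem free_homDegree_involutionEigen {c : ℂ} (hc : c * c = 1) (d : ℕ) :
    Module.Free ℂ (homDegree (involutionEigen hΦ hα c).toRepresentation d) :=
  have : Module.Free ℂ (LinearMap.range (evalGenerator hΦ hα hc d)) :=
    Module.Free.of_divisionRing ℂ _
  Module.Free.of_equiv (LinearEquiv.ofInjective _ (evalGenerator_injective hΦ hα hc d)).symm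

/-- Evaluation at the generator embeds the space in the finite-dimensional `(S/I)_d`. Finiteness is
what makes `finrank` additive on the product below. -/
theorem finite_homDegree_involutionEigen {c : ℂ} (hc : c * c = 1) (d : ℕ) :
    Module.Finite ℂ (homDegree (involutionEigen hΦ hα c).toRepresentation d) :=
  Module.Finite.of_injective ((evalGenerator hΦ hα hc d).codRestrict (coinvariantDegree W d)
    fun φ => φ.2 _) fun _ _ h => evalGenerator_injective hΦ hα hc d (congrArg Subtype.val h)

/-! ### Splitting equivariant maps along the two eigenspaces -/

/-- Restriction of an equivariant map on `ℂ[Φ']` to an eigenspace of the involution. -/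
def restrictEigen (c : ℂ) (d : ℕ) :
    homDegree (orbitRep W α) d →ₗ[ℂ] homDegree (involutionEigen hΦ hα c).toRepresentation d where
  toFun φ := ⟨⟨φ.1.toLinearMap ∘ₗ (involutionEigen hΦ hα c).toSubmodule.subtype, fun w =>
    LinearMap.ext fun u => φ.1.isIntertwining _ _ w u⟩, fun u => φ.2 u⟩
  map_add' _ _ := rfl
  map_smul' _ _ := rfl

/-- Extension of an equivariant map on an eigenspace along the map `u ↦ u + c T u`. -/
def extendEigen {c : ℂ} (hc : c * c = 1) (d : ℕ) :
    homDegree (involutionEigen hΦ hα c).toRepresentation d →ₗ[ℂ] homDegree (orbitRep W α) d where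
  toFun φ := ⟨⟨φ.1.toLinearMap ∘ₗ eigenMap hΦ hα hc, fun w => LinearMap.ext fun u =>
    (congrArg φ.1 (eigenMap_orbitRep hΦ hα hc w u)).trans (φ.1.isIntertwining _ _ w _)⟩,
    fun _ => φ.2 _⟩
  map_add' _ _ := rfl
  map_smul' _ _ := rfl

theorem eigenMap_add_eigenMap (u : MonoidAlgebra ℂ (RootOrbit W α)) :
    (eigenMap hΦ hα (c := 1) (one_mul 1) u : MonoidAlgebra ℂ (RootOrbit W α)) +
      eigenMap hΦ hα (c := -1) (by norm_num) u = (2 : ℂ) • u := by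
  rw [eigenMap_coe, eigenMap_coe, one_smul, neg_one_smul, two_smul]
  abel

theorem eigenMap_eq_zero {c : ℂ} (hc : c * c = 1) {u : MonoidAlgebra ℂ (RootOrbit W α)}
    (hu : u ∈ (involutionEigen hΦ hα (-c)).toSubmodule) : eigenMap hΦ hα hc u = 0 := by
  refine Subtype.ext ?_
  have hu : orbitInvolution hΦ hα u = (-c) • u := Module.End.mem_eigenspace_iff.1 hu
  rw [eigenMap_coe, hu, smul_smul, mul_neg, hc, neg_one_smul, add_neg_cancel]
  rfl

theorem isCompl_involutionEigen :
    IsCompl (involutionEigen hΦ hα 1).toSubmodule (involutionEigen hΦ hα (-1)).toSubmodule := by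
  refine ⟨Submodule.disjoint_def.2 fun u h1 h2 => ?_, codisjoint_iff.2 (eq_top_iff.2 fun u _ => ?_)⟩
  · have h3 := eigenMap_apply_coe hΦ hα (one_mul 1) ⟨u, h1⟩
    rw [eigenMap_eq_zero hΦ hα (one_mul 1) h2] at h3
    exact congrArg Subtype.val ((smul_eq_zero.1 h3.symm).resolve_left two_ne_zero)
  · rw [← Submodule.smul_mem_iff _ (two_ne_zero (α := ℂ)), ← eigenMap_add_eigenMap hΦ hα]
    exact Submodule.add_mem_sup (Subtype.coe_prop _) (Subtype.coe_prop _)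

theorem finrank_homDegree_orbitRep (d : ℕ) :
    Module.finrank ℂ (homDegree (orbitRep W α) d) =
      Module.finrank ℂ (homDegree (involutionEigen hΦ hα 1).toRepresentation d) +
      Module.finrank ℂ (homDegree (involutionEigen hΦ hα (-1)).toRepresentation d) := by
  have hn : (-1 : ℂ) * -1 = 1 := by norm_num
  have := finite_homDegree_involutionEigen hΦ hα (one_mul 1) d
  have := finite_homDegree_involutionEigen hΦ hα hn d
  have := free_homDegree_involutionEigen hΦ hα (one_mul 1) d
  have := free_homDegree_involutionEigen hΦ hα hn d
  rw [← Module.finrank_prod]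
  refine (LinearEquiv.ofBijective
    ((restrictEigen hΦ hα 1 d).prod (restrictEigen hΦ hα (-1) d)) ⟨?_, ?_⟩).finrank_eq
  · rw [injective_iff_map_eq_zero]
    intro φ hφ
    have h1 (u) : φ.1 (u : (involutionEigen hΦ hα 1).toSubmodule) = 0 :=
      congr($(congrArg Prod.fst hφ).1 u)
    have h2 (u) : φ.1 (u : (involutionEigen hΦ hα (-1)).toSubmodule) = 0 :=
      congr($(congrArg Prod.snd hφ).1 u)
    refine Subtype.ext (Representation.IntertwiningMap.ext (LinearMap.ext fun u => ?_))
    have h3 := congrArg φ.1 (eigenMap_add_eigenMap hΦ hα u)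
    rw [map_add, h1, h2, add_zero, map_smul] at h3
    exact (smul_eq_zero.1 h3.symm).resolve_left two_ne_zero
  · rintro ⟨φ, ψ⟩
    -- Each `eigenMap` is `2` on its own eigenspace and `0` on the other, so half the sum restricts
    -- to the given pair.
    refine ⟨(2 : ℂ)⁻¹ • (extendEigen hΦ hα (one_mul 1) d φ + extendEigen hΦ hα hn d ψ), ?_⟩
    rw [map_smul, inv_smul_eq_iff₀ two_ne_zero]
    refine Prod.ext (Subtype.ext (Representation.IntertwiningMap.ext (LinearMap.ext fun u => ?_)))
      (Subtype.ext (Representation.IntertwiningMap.ext (LinearMap.ext fun u => ?_)))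
    · change φ.1 (eigenMap hΦ hα (one_mul 1) u) + ψ.1 (eigenMap hΦ hα hn u) = (2 : ℂ) • φ.1 u
      rw [eigenMap_apply_coe, eigenMap_eq_zero hΦ hα hn (by rw [neg_neg]; exact u.2), map_zero,
        add_zero, map_smul]
    · change φ.1 (eigenMap hΦ hα (one_mul 1) u) + ψ.1 (eigenMap hΦ hα hn u) = (2 : ℂ) • ψ.1 u
      rw [eigenMap_apply_coe, eigenMap_eq_zero hΦ hα (one_mul 1) u.2, map_zero,
        zero_add, map_smul]

end ReflFakeDegree

end

/-! ### The relations between the fake degrees -/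

open ReflFakeDegree in
theorem proposition4p3 (l : ℕ)
    (W : Subgroup (EuclideanSpace ℝ (Fin l) ≃ₗ[ℝ] EuclideanSpace ℝ (Fin l)))
    (hW : IsFiniteReflectionGroup W) (Φ : Set (EuclideanSpace ℝ (Fin l)))
    (hΦ : IsRootSystem W Φ) (α : EuclideanSpace ℝ (Fin l)) (hα : α ∈ Φ)
    (f fsym fanti : ℤ⟦X⟧)
    (hf : f = fakeDegree (orbitRep W α))
    (hfsym : fsym = fakeDegree (symmetricPart hΦ hα).toRepresentation)
    (hfanti : fanti = fakeDegree (antisymmetricPart hΦ hα).toRepresentation) :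
    IsCompl (symmetricPart hΦ hα).toSubmodule (antisymmetricPart hΦ hα).toSubmodule ∧
    f = fsym + fanti ∧
    fanti = PowerSeries.X * fsym ∧
    -- the two relations determine the triple from any one of its members
    ∀ a b c : ℤ⟦X⟧, a = b + c → c = PowerSeries.X * b → (a = f ∨ b = fsym ∨ c = fanti) →
      a = f ∧ b = fsym ∧ c = fanti := by
  have := hW.finite
  have hsum : f = fsym + fanti := by
    subst hf hfsym hfanti
    ext d
    rw [map_add, fakeDegree, fakeDegree, fakeDegree, PowerSeries.coeff_mk, PowerSeries.coeff_mk,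
      PowerSeries.coeff_mk]
    exact_mod_cast finrank_homDegree_orbitRep hΦ hα d
  have hq : fanti = PowerSeries.X * fsym := by
    have hs : (⟨hyperplaneReflection α, hΦ.reflection_mem α hα⟩ : W).1 = hyperplaneReflection α :=
      rfl
    have hn : (-1 : ℂ) * -1 = 1 := by norm_num
    subst hfsym hfanti
    ext d
    cases d with
    | zero =>
      rw [PowerSeries.coeff_zero_X_mul, fakeDegree, PowerSeries.coeff_mk, antisymmetricPart,
        finrank_homDegree_involutionEigen hΦ hα hs hn, semiInvariants_neg_one_zero, finrank_bot]
      rfl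
    | succ d =>
      rw [PowerSeries.coeff_succ_X_mul, fakeDegree, fakeDegree, PowerSeries.coeff_mk,
        PowerSeries.coeff_mk, antisymmetricPart, symmetricPart,
        finrank_homDegree_involutionEigen hΦ hα hs hn,
        finrank_homDegree_involutionEigen hΦ hα hs (one_mul 1),
        finrank_semiInvariants_succ (fun _ => hW.preservesInner) (hΦ.ne_zero α hα) hs]
  refine ⟨isCompl_involutionEigen hΦ hα, hsum, hq, fun a b c ha hc h => ?_⟩
  suffices hb : b = fsym by
    subst hb
    exact ⟨by rw [ha, hc, hsum, hq], rfl, by rw [hc, hq]⟩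
  rcases h with h | h | h
  -- Both `b` and `fsym` give `f` when multiplied by `1 + q`, which is nonzero in a domain.
  · have hX : (1 + PowerSeries.X : ℤ⟦X⟧) ≠ 0 := fun h0 => by
      simpa using congrArg (PowerSeries.coeff 0) h0
    refine mul_left_cancel₀ hX ?_
    rw [add_mul, one_mul, add_mul, one_mul, ← hc, ← hq, ← ha, ← hsum, h]
  · exact h
  · exact mul_left_cancel₀ PowerSeries.X_ne_zero (by rw [← hc, ← hq, h])
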